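/- A permutation $\pi\in S_n$ contains a pattern $\sigma\in S_m$ if there are indices $i_1<\dots<i_m$ such that $\pi_{i_1}\cdots\pi_{i_m}$ is in the same relative order as $\sigma_1\cdots\sigma_m$; otherwise it avoids $\sigma$. For a set $\Sigma$ of patterns let $S_n(\Sigma)$ be the set of permutations in $S_n$ that avoid every element of $\Sigma$. For $\pi\in S_n$ let $\mathrm{fp}(\pi)$ be the number of $i$ with $\pi_i=i$ and $\mathrm{exc}(\pi)$ the number of $i$ with $\pi_i>i$. Define the formal power series $$F_\Sigma(x,q,z)=\sum_{n\ge 0}\ \sum_{\pi\in S_n(\Sigma)}x^{\mathrm{fp}(\pi)}q^{\mathrm{exc}(\pi)}z^n\in\mathbb{Z}[x,q][[z]].$$ **Theorem.** The generating functions $F_\Sigma$ for the sets $\Sigma$ of three patterns of length 3 are as follows. **a)** $$F_{\{123,132,213\}}(x,q,z)=\frac{1 + xz + (x^2 - q)z^2 + (-xq + q^2 + q)z^3 - x^2qz^4}{(1 + qz^2)(1 - 3qz^2 + q^2z^4)}$$ **b)** $$F_{\{231,312,321\}}(x,q,z)=\frac{1}{1 - xz - qz^2}$$ **c)** $$F_{\{123,132,231\}}(x,q,z)=F_{\{123,213,231\}}(x,q,z)=\frac{1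 + xz + (x^2 - q)z^2 + qz^3 + (-x^2q + xq + q^2)z^4}{(1 - qz^2)^2}$$ **c')** $$F_{\{123,132,312\}}(x,q,z)=F_{\{123,213,312\}}(x,q,z)=\frac{1 + xz + (x^2 - q)z^2 + q^2z^3 + (-x^2q + xq^2 + q^2)z^4}{(1 - qz^2)^2}$$ **d)** $$F_{\{132,231,321\}}(x,q,z)=F_{\{213,231,321\}}(x,q,z)=\frac{1 - z + qz^2}{(1 - z)(1 - xz)}$$ **d')** $$F_{\{132,312,321\}}(x,q,z)=F_{\{213,312,321\}}(x,q,z)=\frac{1 - qz + qz^2}{(1 - xz)(1 - qz)}$$ **e)** $$F_{\{132,213,231\}}(x,q,z)=\frac{1 - z - qz^2 + 2qz^3 + (-x^2q + q^2 - xq)z^4 + (x^2q - 2q^2)z^5 + xq^2z^6}{(1 - z)(1 - xz)(1 - qz^2)^2}$$ **e')** $$F_{\{132,213,312\}}(x,q,z)=\frac{1 - qz - qz^2 + 2q^2z^3 + (-x^2q - xq^2 + q^2)z^4 + (x^2q^2 - 2q^3)z^5 + xq^3z^6}{(1 - xz)(1 - qz)(1 - qz^2)^2}$$ **f)** $$F_{\{132,231,312\}}(x,q,z)=F_{\{213,231,312\}}(x,q,z)=\frac{1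 + xqz^3}{(1 - xz)(1 - qz^2)}$$ **g)** $$F_{\{123,231,312\}}(x,q,z)=\frac{1 + xz + (x^2 - q)z^2 + xqz^3 + q^2z^4}{(1 - qz^2)^2}$$ **h)** $$F_{\{132,213,321\}}(x,q,z)=\frac{1 - (1 + q)z + 2qz^2 - xqz^3}{(1 - z)(1 - xz)(1 - qz)}$$ **i)** $$F_{\{123,132,321\}}(x,q,z)=F_{\{123,213,321\}}(x,q,z)=1 + xz + (x^2 + q)z^2 + (xq + q^2 + q)z^3 + q^2z^4$$ **j)** $$F_{\{123,231,321\}}(x,q,z)=1 + xz + (x^2 + q)z^2 + (2xq + q)z^3 + q^2z^4$$ **j')** $$F_{\{123,312,321\}}(x,q,z)=1 + xz + (x^2 + q)z^2 + (2xq + q^2)z^3 + q^2z^4$$ The twenty sets listed above are all the three-element subsets of $S_3$. -/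

import Mathlib

open scoped PowerSeries

namespace PatternAvoidance

/-- A pattern: a permutation of some finite length `k`. -/
abbrev Pattern : Type := Σ k : ℕ, Equiv.Perm (Fin k)

/-- `π` contains `σ`: there are indices `i₁ < ⋯ < iₘ` (the values of `f`) such that
`π i₁, …, π iₘ` is in the same relative order as `σ 1, …, σ m`. -/
def Contains {n m : ℕ} (π : Equiv.Perm (Fin n)) (σ : Equiv.Perm (Fin m)) : Prop :=
  ∃ f : Fin m → Fin n, StrictMono f ∧ ∀ i j : Fin m, π (f i) < π (f j) ↔ σ i < σ j

/-- `π` avoids every pattern in `S`. -/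
def Avoids {n : ℕ} (π : Equiv.Perm (Fin n)) (S : Set Pattern) : Prop :=
  ∀ p ∈ S, ¬ Contains π p.2

/-- The number of fixed points. -/
def fp {n : ℕ} (π : Equiv.Perm (Fin n)) : ℕ :=
  (Finset.univ.filter fun i : Fin n => π i = i).card

/-- The number of excedances. -/
def exc {n : ℕ} (π : Equiv.Perm (Fin n)) : ℕ :=
  (Finset.univ.filter fun i : Fin n => i < π i).card

/-- `ℤ[x, q]`, where `x` and `q` are the variables with index `0` and `1`. -/
abbrev Coeffs : Type := MvPolynomial (Fin 2) ℤ

open Classical in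
/-- `F_S(x, q, z) = ∑ₙ ∑_π x ^ fp π * q ^ exc π * z ^ n`, where `π` runs over the permutations of
length `n` that avoid `S`, as a formal power series in `z` over `ℤ[x, q]`. -/
noncomputable def F (S : Set Pattern) : Coeffs⟦X⟧ :=
  PowerSeries.mk fun n : ℕ =>
    ∑ π : Equiv.Perm (Fin n) with Avoids π S,
      (MvPolynomial.X 0 : Coeffs) ^ fp π * (MvPolynomial.X 1 : Coeffs) ^ exc π

/-- The variable `x` as a power series. -/
noncomputable def varX : Coeffs⟦X⟧ := PowerSeries.C (MvPolynomial.X 0 : Coeffs)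

/-- The variable `q` as a power series. -/
noncomputable def varQ : Coeffs⟦X⟧ := PowerSeries.C (MvPolynomial.X 1 : Coeffs)

/-- The variable `z` as a power series. -/
noncomputable def varZ : Coeffs⟦X⟧ := PowerSeries.X

/-- The fraction `a / b` of power series, for an invertible denominator `b`. -/
noncomputable def frac (a b : Coeffs⟦X⟧) : Coeffs⟦X⟧ := a * Ring.inverse b

/-- The pattern `123` in one-line notation. -/
def p123 : Pattern :=
  ⟨3, ⟨![0, 1, 2], ![0, 1, 2], by decide, by decide⟩⟩

/-- The pattern `132` in one-line notation. -/
def p132 : Pattern :=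
  ⟨3, ⟨![0, 2, 1], ![0, 2, 1], by decide, by decide⟩⟩

/-- The pattern `213` in one-line notation. -/
def p213 : Pattern :=
  ⟨3, ⟨![1, 0, 2], ![1, 0, 2], by decide, by decide⟩⟩

/-- The pattern `231` in one-line notation. -/
def p231 : Pattern :=
  ⟨3, ⟨![1, 2, 0], ![2, 0, 1], by decide, by decide⟩⟩

/-- The pattern `312` in one-line notation. -/
def p312 : Pattern :=
  ⟨3, ⟨![2, 0, 1], ![1, 2, 0], by decide, by decide⟩⟩

/-- The pattern `321` in one-line notation. -/
def p321 : Pattern :=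
  ⟨3, ⟨![2, 1, 0], ![2, 1, 0], by decide, by decide⟩⟩

end PatternAvoidance

open PatternAvoidance

/-!
Recording anti-excedances by a third variable `r` gives generating functions in which inverting the
patterns exchanges `q` and `r`, and which are invariant under reflecting the patterns in the
antidiagonal. One representative of each orbit therefore suffices.

Deleting the minimum of a permutation leaves pairs of entries to its right, around it, and to its
left, whose relative orders are governed by the pairs of patterns `{123, 132}`, `{213, 312}` and
`{231, 321}`. If the three patterns meet each of these pairs, an avoiding permutation is determined
by the position of its minimum. Of the remaining orbits, `{231, 312, 321}` is avoided by the layered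
permutations with layers of size at most two, which are peeled off one by one, and
`{123, 132, 213}` by their complements, whose weights are products of Fibonacci numbers because
entries on the same side of the antidiagonal weigh the same. If both `123` and `321` occur, then
by Erdős–Szekeres only permutations of length at most four remain.
-/

namespace PatternAvoidance

open Equiv (Perm)
open Finset hiding mk

section Containment

variable {n m : ℕ} {π : Perm (Fin n)}

lemma contains_iff_strictMono {σ : Perm (Fin m)} :
    Contains π σ ↔ ∃ f : Fin m → Fin n, StrictMono f ∧ StrictMono fun i => π (f (σ⁻¹ i)) := by
  refine exists_congr fun f => and_congr_right fun _ => ⟨fun h i j hij => ?_, fun h i j => ?_⟩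
  · simpa [h] using hij
  · simpa using h.lt_iff_lt (a := σ i) (b := σ j)

lemma contains_iff_of_length_three {σ : Perm (Fin 3)} :
    Contains π σ ↔ ∃ a b c, a < b ∧ b < c ∧
      π (![a, b, c] (σ⁻¹ 0)) < π (![a, b, c] (σ⁻¹ 1)) ∧
      π (![a, b, c] (σ⁻¹ 1)) < π (![a, b, c] (σ⁻¹ 2)) := by
  simp only [contains_iff_strictMono, Fin.strictMono_iff_lt_succ, Fin.forall_fin_two]
  constructor
  · rintro ⟨f, hf, hπ⟩
    have hf' : ![f 0, f 1, f 2] = f := by ext i; fin_cases i <;> rfl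
    exact ⟨f 0, f 1, f 2, hf.1, hf.2, by rw [hf']; exact hπ⟩
  · rintro ⟨a, b, c, hab, hbc, hπ⟩
    exact ⟨![a, b, c], ⟨hab, hbc⟩, hπ⟩

lemma contains_p123 : Contains π p123.2 ↔ ∃ a b c, a < b ∧ b < c ∧ π a < π b ∧ π b < π c :=
  contains_iff_of_length_three

lemma contains_p132 : Contains π p132.2 ↔ ∃ a b c, a < b ∧ b < c ∧ π a < π c ∧ π c < π b :=
  contains_iff_of_length_three

lemma contains_p213 : Contains π p213.2 ↔ ∃ a b c, a < b ∧ b < c ∧ π b < π a ∧ π a < π c :=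
  contains_iff_of_length_three

lemma contains_p231 : Contains π p231.2 ↔ ∃ a b c, a < b ∧ b < c ∧ π c < π a ∧ π a < π b :=
  contains_iff_of_length_three

lemma contains_p312 : Contains π p312.2 ↔ ∃ a b c, a < b ∧ b < c ∧ π b < π c ∧ π c < π a :=
  contains_iff_of_length_three

lemma contains_p321 : Contains π p321.2 ↔ ∃ a b c, a < b ∧ b < c ∧ π c < π b ∧ π b < π a :=
  contains_iff_of_length_three

lemma avoids_triple {p₁ p₂ p₃ : Pattern} : Avoids π {p₁, p₂, p₃} ↔
    ¬ Contains π p₁.2 ∧ ¬ Contains π p₂.2 ∧ ¬ Contains π p₃.2 := by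
  simp [Avoids]

end Containment

section Symmetry

/-- A symmetry of pattern containment: an involution of the permutations of each length under which
containment of patterns is invariant. -/
structure PatternSymmetry where
  /-- The involution on permutations of length `n`. -/
  toFun : ∀ {n : ℕ}, Perm (Fin n) → Perm (Fin n)
  involutive : ∀ {n : ℕ}, Function.Involutive (toFun : Perm (Fin n) → Perm (Fin n))
  contains : ∀ {n m : ℕ} {π : Perm (Fin n)} {σ : Perm (Fin m)},
    Contains π σ → Contains (toFun π) (toFun σ)

namespace PatternSymmetry

/-- The action of a symmetry on patterns. -/
def map (s : PatternSymmetry) (p : Pattern) : Pattern := ⟨p.1, s.toFun p.2⟩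

lemma contains_toFun_iff (s : PatternSymmetry) {n m : ℕ} {π : Perm (Fin n)} {σ : Perm (Fin m)} :
    Contains (s.toFun π) (s.toFun σ) ↔ Contains π σ :=
  ⟨fun h => by simpa only [s.involutive _] using s.contains h, s.contains⟩

lemma avoids_toFun_image_map_iff (s : PatternSymmetry) {n : ℕ} {π : Perm (Fin n)}
    {S : Set Pattern} : Avoids (s.toFun π) (s.map '' S) ↔ Avoids π S := by
  simp only [Avoids, Set.forall_mem_image, map, contains_toFun_iff]

lemma image_map_triple (s : PatternSymmetry) (p₁ p₂ p₃ : Pattern) :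
    s.map '' {p₁, p₂, p₃} = {s.map p₁, s.map p₂, s.map p₃} := by
  rw [Set.image_insert_eq, Set.image_pair]

/-- Inversion of permutations. -/
def inv : PatternSymmetry where
  toFun π := π⁻¹
  involutive := inv_inv
  contains {n m π σ} := by
    simp only [contains_iff_strictMono]
    rintro ⟨f, hf, hπ⟩
    exact ⟨fun i => π (f (σ⁻¹ i)), hπ, by simpa using hf⟩

/-- Complementation `π ↦ (n - 1 - π i)ᵢ`. -/
def compl : PatternSymmetry where
  toFun π := Fin.revPerm * π
  involutive π := by ext; simp
  contains := by
    rintro n m π σ ⟨f, hf, hπ⟩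
    exact ⟨f, hf, fun i j => by simpa using hπ j i⟩

/-- Reflection of the permutation matrix in its antidiagonal, which is the composite of inversion,
reversal and complementation. -/
def antitranspose : PatternSymmetry where
  toFun π := Fin.revPerm * π⁻¹ * Fin.revPerm
  involutive π := by ext; simp [mul_assoc]
  contains {n m π σ} := by
    simp only [contains_iff_strictMono]
    rintro ⟨f, hf, hπ⟩
    refine ⟨fun i => (π (f (σ⁻¹ i.rev))).rev, fun i j hij => ?_, fun i j hij => ?_⟩
    · simpa using hπ (Fin.rev_lt_rev.2 hij)
    · simpa [Equiv.Perm.inv_def] using hf (Fin.rev_lt_rev.2 hij)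

lemma map_inv_p123 : inv.map p123 = p123 := rfl

lemma map_inv_p132 : inv.map p132 = p132 := rfl

lemma map_inv_p213 : inv.map p213 = p213 := rfl

lemma map_inv_p231 : inv.map p231 = p312 := rfl

lemma map_inv_p321 : inv.map p321 = p321 := rfl

lemma map_compl_p231 : compl.map p231 = p213 :=
  congrArg (Sigma.mk 3) (Equiv.ext (by decide))

lemma map_compl_p312 : compl.map p312 = p132 :=
  congrArg (Sigma.mk 3) (Equiv.ext (by decide))

lemma map_compl_p321 : compl.map p321 = p123 :=
  congrArg (Sigma.mk 3) (Equiv.ext (by decide))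

lemma map_antitranspose_p123 : antitranspose.map p123 = p123 :=
  congrArg (Sigma.mk 3) (Equiv.ext (by decide))

lemma map_antitranspose_p132 : antitranspose.map p132 = p213 :=
  congrArg (Sigma.mk 3) (Equiv.ext (by decide))

lemma map_antitranspose_p231 : antitranspose.map p231 = p231 :=
  congrArg (Sigma.mk 3) (Equiv.ext (by decide))

lemma map_antitranspose_p312 : antitranspose.map p312 = p312 :=
  congrArg (Sigma.mk 3) (Equiv.ext (by decide))

lemma map_antitranspose_p321 : antitranspose.map p321 = p321 :=
  congrArg (Sigma.mk 3) (Equiv.ext (by decide))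

end PatternSymmetry

end Symmetry

section Weights

variable {A : Type*}

/-- The weight of an entry `j` at position `i` of a permutation: `x` for fixed points, `q` for
excedances, and `r` for anti-excedances. The third variable makes inversion act on generating
functions by exchanging `q` and `r`. -/
def entryWeight (x q r : A) (i j : ℕ) : A := if j = i then x else if i < j then q else r

variable {x q r : A} {i j : ℕ}

lemma entryWeight_of_eq (h : j = i) : entryWeight x q r i j = x := if_pos h

lemma entryWeight_of_lt (h : i < j) : entryWeight x q r i j = q := by
  rw [entryWeight, if_neg h.ne', if_pos h]

lemma entryWeight_of_gt (h : j < i) : entryWeight x q r i j = r := by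
  rw [entryWeight, if_neg h.ne, if_neg h.not_gt]

lemma entryWeight_congr {i' j' : ℕ} (heq : j = i ↔ j' = i') (hlt : i < j ↔ i' < j') :
    entryWeight x q r i j = entryWeight x q r i' j' := by
  simp only [entryWeight, heq, hlt]

lemma entryWeight_swap : (fun i j => entryWeight x q r j i) = entryWeight x r q := by
  ext i j
  grind [entryWeight]

variable [CommSemiring A]

open Classical in
/-- The total weight of the permutations of length `n` that avoid `S`, where `π` has the weight
`∏ i, w i (π i)`. -/
noncomputable def weightSum (S : Set Pattern) (n : ℕ) (w : ℕ → ℕ → A) : A :=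
  ∑ π : Perm (Fin n) with Avoids π S, ∏ i : Fin n, w i (π i)

lemma weightSum_congr {S : Set Pattern} {n : ℕ} {w w' : ℕ → ℕ → A}
    (h : ∀ i < n, ∀ j < n, w i j = w' i j) : weightSum S n w = weightSum S n w' :=
  sum_congr rfl fun π _ => prod_congr rfl fun i _ => h i i.2 (π i) (π i).2

lemma weightSum_zero {S : Set Pattern} (hS : ∀ p ∈ S, 0 < p.1) (w : ℕ → ℕ → A) :
    weightSum S 0 w = 1 := by
  have havoids (π : Perm (Fin 0)) : Avoids π S := fun p hp ⟨f, _⟩ => (f ⟨0, hS p hp⟩).elim0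
  simp [weightSum, havoids]

open Classical in
lemma weightSum_image_map (s : PatternSymmetry) (S : Set Pattern) (n : ℕ) (w : ℕ → ℕ → A) :
    weightSum (s.map '' S) n w =
      ∑ π : Perm (Fin n) with Avoids π S, ∏ i : Fin n, w i (s.toFun π i) :=
  (sum_equiv (s.involutive (n := n)).toPerm (by simp [s.avoids_toFun_image_map_iff])
    fun π _ => rfl).symm

lemma weightSum_image_map_inv (S : Set Pattern) (n : ℕ) (w : ℕ → ℕ → A) :
    weightSum (PatternSymmetry.inv.map '' S) n w = weightSum S n fun i j => w j i := by
  rw [weightSum_image_map]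
  refine sum_congr rfl fun π _ => ?_
  rw [← Equiv.prod_comp π]
  simp [PatternSymmetry.inv]

lemma weightSum_image_map_compl (S : Set Pattern) (n : ℕ) (w : ℕ → ℕ → A) :
    weightSum (PatternSymmetry.compl.map '' S) n w =
      weightSum S n fun i j => w i (n - (j + 1)) := by
  rw [weightSum_image_map]
  simp [PatternSymmetry.compl, weightSum, Fin.val_rev]

lemma weightSum_image_map_antitranspose (S : Set Pattern) (n : ℕ) (w : ℕ → ℕ → A) :
    weightSum (PatternSymmetry.antitranspose.map '' S) n w =
      weightSum S n fun i j => w (n - (j + 1)) (n - (i + 1)) := by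
  rw [weightSum_image_map]
  refine sum_congr rfl fun π _ => ?_
  rw [← Equiv.prod_comp (π.trans Fin.revPerm)]
  simp [PatternSymmetry.antitranspose, Fin.val_rev]

/-- The number of anti-excedances. -/
def antiexc {n : ℕ} (π : Perm (Fin n)) : ℕ := #{i : Fin n | π i < i}

lemma prod_entryWeight {n : ℕ} (x q r : A) (π : Perm (Fin n)) :
    ∏ i : Fin n, entryWeight x q r i (π i) = x ^ fp π * q ^ exc π * r ^ antiexc π := by
  have hsplit (i : Fin n) : entryWeight x q r i (π i) =
      ((if π i = i then x else 1) * if i < π i then q else 1) * if π i < i then r else 1 := by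
    grind [entryWeight]
  simp only [hsplit, prod_mul_distrib, prod_ite, prod_const, one_pow, mul_one, fp, exc, antiexc]

/-- The generating function of the permutations that avoid `S` by their numbers of fixed points,
excedances and anti-excedances. -/
noncomputable def genFun (S : Set Pattern) (x q r : A) : A⟦X⟧ :=
  PowerSeries.mk fun n => weightSum S n (entryWeight x q r)

lemma F_eq_genFun (S : Set Pattern) :
    F S = genFun S (MvPolynomial.X 0 : Coeffs) (MvPolynomial.X 1) 1 := by
  simp only [F, genFun, weightSum, prod_entryWeight, one_pow, mul_one]

lemma genFun_image_map_inv (S : Set Pattern) (x q r : A) :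
    genFun (PatternSymmetry.inv.map '' S) x q r = genFun S x r q := by
  simp only [genFun, weightSum_image_map_inv, entryWeight_swap]

lemma genFun_image_map_antitranspose (S : Set Pattern) (x q r : A) :
    genFun (PatternSymmetry.antitranspose.map '' S) x q r = genFun S x q r := by
  simp only [genFun, weightSum_image_map_antitranspose]
  congr! 2 with n
  exact weightSum_congr fun i hi j hj => entryWeight_congr (by omega) (by omega)

end Weights

section MinimumPosition

lemma perm_eq_of_lt_iff_lt {n : ℕ} {π τ : Perm (Fin n)}
    (h : ∀ i j, i < j → (π i < π j ↔ τ i < τ j)) : π = τ := by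
  have hmono : StrictMono (τ * π⁻¹) := fun a b hab => by
    obtain ⟨i, rfl⟩ := π.surjective a
    obtain ⟨j, rfl⟩ := π.surjective b
    have hne : i ≠ j := fun hij => hab.ne (congrArg π hij)
    rcases lt_or_gt_of_ne hne with hij | hij
    · simpa [h i j hij] using hab
    · have hle := (h j i hij).not.1 hab.not_gt
      simpa using (not_lt.1 hle).lt_of_ne (τ.injective.ne hne)
  have hid := congrArg RelIso.toEquiv
    (Subsingleton.elim (hmono.orderIsoOfSurjective _ (τ * π⁻¹).surjective) (OrderIso.refl _))
  exact (mul_inv_eq_one.1 (Equiv.ext fun i => congrArg (· i) hid : τ * π⁻¹ = 1)).symm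

variable {S : Set Pattern} {n : ℕ}

lemma Avoids.not_lt_of_lt_of_apply_eq_zero (hright : p123 ∈ S ∨ p132 ∈ S)
    (hmid : p213 ∈ S ∨ p312 ∈ S) (hleft : p231 ∈ S ∨ p321 ∈ S) {π τ : Perm (Fin (n + 1))}
    (hπ : Avoids π S) (hτ : Avoids τ S) {k i j : Fin (n + 1)} (hπk : π k = 0) (hτk : τ k = 0)
    (hij : i < j) (h : π i < π j) : ¬ τ j < τ i := by
  intro h'
  have min_lt {ρ : Perm (Fin (n + 1))} (hρ : ρ k = 0) {i : Fin (n + 1)} (hi : i ≠ k) :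
      ρ k < ρ i := by
    rw [hρ, Fin.pos_iff_ne_zero, ← hρ]
    exact ρ.injective.ne hi
  have hik : i ≠ k := by
    rintro rfl
    simp [hτk] at h'
  have hjk : j ≠ k := by
    rintro rfl
    simp [hπk] at h
  rcases lt_or_gt_of_ne hik with hik' | hki
  · rcases lt_or_gt_of_ne hjk with hjk' | hkj
    · rcases hleft with hS | hS
      · exact hπ _ hS (contains_p231.2 ⟨i, j, k, hij, hjk', min_lt hπk hik, h⟩)
      · exact hτ _ hS (contains_p321.2 ⟨i, j, k, hij, hjk', min_lt hτk hjk, h'⟩)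
    · rcases hmid with hS | hS
      · exact hπ _ hS (contains_p213.2 ⟨i, k, j, hik', hkj, min_lt hπk hik, h⟩)
      · exact hτ _ hS (contains_p312.2 ⟨i, k, j, hik', hkj, min_lt hτk hjk, h'⟩)
  · rcases hright with hS | hS
    · exact hπ _ hS (contains_p123.2 ⟨k, i, j, hki, hij, min_lt hπk hik, h⟩)
    · exact hτ _ hS (contains_p132.2 ⟨k, i, j, hki, hij, min_lt hτk hjk, h'⟩)

/-- A pair of positions lies to the right of the minimum, around it, or to its left; in each case
one of the hypotheses fixes the relative order of the two entries. -/
lemma Avoids.eq_of_apply_eq_zero (hright : p123 ∈ S ∨ p132 ∈ S) (hmid : p213 ∈ S ∨ p312 ∈ S)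
    (hleft : p231 ∈ S ∨ p321 ∈ S) {π τ : Perm (Fin (n + 1))} (hπ : Avoids π S) (hτ : Avoids τ S)
    {k : Fin (n + 1)} (hπk : π k = 0) (hτk : τ k = 0) : π = τ := by
  refine perm_eq_of_lt_iff_lt fun i j hij => ⟨fun h => ?_, fun h => ?_⟩
  · exact (not_lt.1 (hπ.not_lt_of_lt_of_apply_eq_zero hright hmid hleft hτ hπk hτk hij h)).lt_of_ne
      (τ.injective.ne hij.ne)
  · exact (not_lt.1 (hτ.not_lt_of_lt_of_apply_eq_zero hright hmid hleft hπ hτk hπk hij h)).lt_of_ne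
      (π.injective.ne hij.ne)

lemma exists_perm_coe_eq {f : ℕ → ℕ} (hlt : ∀ i < n, f i < n)
    (hinj : Set.InjOn f (Set.Iio n)) : ∃ π : Perm (Fin n), ∀ i, (π i : ℕ) = f i :=
  ⟨Equiv.ofBijective (fun i : Fin n => ⟨f i, hlt i i.2⟩) (Finite.injective_iff_bijective.1
    fun i j hij => Fin.ext (hinj i.2 j.2 (congrArg Fin.val hij))), fun _ => rfl⟩

/-- Here `f k l` is the one-line notation of the avoiding permutation of length `k + l + 1` whose
minimum is preceded by `k` entries and followed by `l` entries. -/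
lemma weightSum_succ_eq_sum_antidiagonal {A : Type*} [CommSemiring A]
    (hright : p123 ∈ S ∨ p132 ∈ S) (hmid : p213 ∈ S ∨ p312 ∈ S) (hleft : p231 ∈ S ∨ p321 ∈ S)
    {f : ℕ → ℕ → ℕ → ℕ} (hlt : ∀ k l, ∀ i < k + l + 1, f k l i < k + l + 1)
    (hinj : ∀ k l, Set.InjOn (f k l) (Set.Iio (k + l + 1))) (hzero : ∀ k l, f k l k = 0)
    (havoids : ∀ k l (π : Perm (Fin (k + l + 1))), (∀ i, (π i : ℕ) = f k l i) → Avoids π S)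
    (w : ℕ → ℕ → A) :
    weightSum S (n + 1) w =
      ∑ kl ∈ antidiagonal n, ∏ i ∈ range (n + 1), w i (f kl.1 kl.2 i) := by
  classical
  have hexists (k : Fin (n + 1)) :
      ∃ π : Perm (Fin (n + 1)), Avoids π S ∧ ∀ i, (π i : ℕ) = f k (n - k) i := by
    have hn : n = k + (n - k) := by omega
    generalize (k : ℕ) = k', n - (k : ℕ) = l at hn
    subst hn
    obtain ⟨π, hπ⟩ := exists_perm_coe_eq (hlt k' l) (hinj k' l)
    exact ⟨π, havoids k' l π hπ, hπ⟩
  choose σ hσ hσf using hexists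
  have hσk (k : Fin (n + 1)) : σ k k = 0 := Fin.ext (by simp [hσf, hzero])
  rw [weightSum, Nat.sum_antidiagonal_eq_sum_range_succ_mk, ← Fin.sum_univ_eq_sum_range]
  refine (sum_bij' (fun k _ => σ k) (fun π _ => π⁻¹ 0) ?_ ?_ ?_ ?_ ?_).symm
  · simp [hσ]
  · simp
  · exact fun k _ => by simp [← hσk k]
  · intro π hπ
    exact (hσ _).eq_of_apply_eq_zero hright hmid hleft (by simpa using hπ) (hσk _) (by simp)
  · intro k _
    simp [← Fin.prod_univ_eq_prod_range, hσf]

end MinimumPosition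

section MinimumPositionClasses

variable {A : Type*} [CommSemiring A] (x q r : A) (n : ℕ)

/-- The weight of the decreasing permutation of length `n`. -/
def reversalWeight : A := ∏ i ∈ range n, entryWeight x q r i (n - 1 - i)

lemma reversalWeight_add_two : reversalWeight x q r (n + 2) = q * r * reversalWeight x q r n := by
  rw [reversalWeight, prod_range_succ, prod_range_succ', entryWeight_of_lt (by omega),
    entryWeight_of_gt (by omega), mul_assoc, mul_comm]
  exact congrArg _ (prod_congr rfl fun i hi => by
    rw [mem_range] at hi
    exact entryWeight_congr (by omega) (by omega))

variable {x q r n} in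
lemma prod_entryWeight_eq_reversalWeight {f g : ℕ → ℕ}
    (h : ∀ i < n, (g i = f i ↔ n - 1 - i = i) ∧ (f i < g i ↔ i < n - 1 - i)) :
    ∏ i ∈ range n, entryWeight x q r (f i) (g i) = reversalWeight x q r n :=
  prod_congr rfl fun i hi =>
    entryWeight_congr (h i (mem_range.1 hi)).1 (h i (mem_range.1 hi)).2

variable {x q r n} in
lemma prod_entryWeight_eq_pow {f g : ℕ → ℕ} {a b : ℕ}
    (h : ∀ i < n, (g i = f i ↔ b = a) ∧ (f i < g i ↔ a < b)) :
    ∏ i ∈ range n, entryWeight x q r (f i) (g i) = entryWeight x q r a b ^ n := by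
  rw [prod_congr rfl fun i hi =>
    entryWeight_congr (h i (mem_range.1 hi)).1 (h i (mem_range.1 hi)).2, prod_const, card_range]

lemma weightSum_succ_132_231_312 :
    weightSum {p132, p231, p312} (n + 1) (entryWeight x q r) =
      ∑ kl ∈ antidiagonal n, reversalWeight x q r (kl.1 + 1) * x ^ kl.2 := by
  rw [weightSum_succ_eq_sum_antidiagonal (by simp) (by simp) (by simp)
    (f := fun k _ i => if i ≤ k then k - i else i)]
  · refine sum_congr rfl fun ⟨k, l⟩ hkl => ?_
    obtain rfl : k + l = n := mem_antidiagonal.1 hkl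
    rw [add_right_comm, prod_range_add, prod_entryWeight_eq_reversalWeight (by grind),
      prod_entryWeight_eq_pow (a := 0) (b := 0) (by grind), entryWeight_of_eq rfl]
  · grind
  · grind [Set.InjOn]
  · simp
  · intro k l π hπ
    simp only [avoids_triple, contains_p132, contains_p231, contains_p312, Fin.lt_def, hπ]
    grind

lemma weightSum_succ_123_231_312 :
    weightSum {p123, p231, p312} (n + 1) (entryWeight x q r) =
      ∑ kl ∈ antidiagonal n, reversalWeight x q r (kl.1 + 1) * reversalWeight x q r kl.2 := by
  rw [weightSum_succ_eq_sum_antidiagonal (by simp) (by simp) (by simp)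
    (f := fun k l i => if i ≤ k then k - i else k + l + 1 + k - i)]
  · refine sum_congr rfl fun ⟨k, l⟩ hkl => ?_
    obtain rfl : k + l = n := mem_antidiagonal.1 hkl
    rw [add_right_comm, prod_range_add, prod_entryWeight_eq_reversalWeight (by grind),
      prod_entryWeight_eq_reversalWeight (by grind)]
  · grind
  · grind [Set.InjOn]
  · simp
  · intro k l π hπ
    simp only [avoids_triple, contains_p123, contains_p231, contains_p312, Fin.lt_def, hπ]
    grind

lemma weightSum_succ_132_312_321 :
    weightSum {p132, p312, p321} (n + 1) (entryWeight x q r) =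
      ∑ kl ∈ antidiagonal n, q ^ kl.1 * entryWeight x q r kl.1 0 * x ^ kl.2 := by
  rw [weightSum_succ_eq_sum_antidiagonal (by simp) (by simp) (by simp)
    (f := fun k l i => if i < k then i + 1 else if i = k then 0 else i)]
  · refine sum_congr rfl fun ⟨k, l⟩ hkl => ?_
    obtain rfl : k + l = n := mem_antidiagonal.1 hkl
    rw [add_right_comm, prod_range_add, prod_range_succ,
      prod_entryWeight_eq_pow (a := 0) (b := 1) (by grind), entryWeight_of_lt one_pos,
      prod_entryWeight_eq_pow (a := 0) (b := 0) (by grind), entryWeight_of_eq rfl]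
    simp
  · grind
  · grind [Set.InjOn]
  · simp
  · intro k l π hπ
    simp only [avoids_triple, contains_p132, contains_p312, contains_p321, Fin.lt_def, hπ]
    grind

lemma weightSum_succ_132_213_321 :
    weightSum {p132, p213, p321} (n + 1) (entryWeight x q r) =
      ∑ kl ∈ antidiagonal n, q ^ kl.1 * entryWeight x q r kl.1 0 ^ (kl.2 + 1) := by
  rw [weightSum_succ_eq_sum_antidiagonal (by simp) (by simp) (by simp)
    (f := fun k l i => if i < k then l + 1 + i else i - k)]
  · refine sum_congr rfl fun ⟨k, l⟩ hkl => ?_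
    obtain rfl : k + l = n := mem_antidiagonal.1 hkl
    rw [add_assoc, prod_range_add,
      prod_entryWeight_eq_pow (a := 0) (b := 1) (by grind), entryWeight_of_lt one_pos,
      prod_entryWeight_eq_pow (a := k) (b := 0) (by grind)]
  · grind
  · grind [Set.InjOn]
  · simp
  · intro k l π hπ
    simp only [avoids_triple, contains_p132, contains_p213, contains_p321, Fin.lt_def, hπ]
    grind

lemma weightSum_succ_132_213_231 :
    weightSum {p132, p213, p231} (n + 1) (entryWeight x q r) =
      ∑ kl ∈ antidiagonal n,
        if kl.1 ≤ kl.2 + 1 then q ^ kl.1 * entryWeight x q r kl.1 0 ^ (kl.2 + 1)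
        else reversalWeight x q r (kl.1 + kl.2 + 1) := by
  rw [weightSum_succ_eq_sum_antidiagonal (by simp) (by simp) (by simp)
    (f := fun k l i => if i < k then k + l - i else i - k)]
  · refine sum_congr rfl fun ⟨k, l⟩ hkl => ?_
    obtain rfl : k + l = n := mem_antidiagonal.1 hkl
    split_ifs with hle
    · rw [add_assoc, prod_range_add,
        prod_entryWeight_eq_pow (a := 0) (b := 1) (by grind), entryWeight_of_lt one_pos,
        prod_entryWeight_eq_pow (a := k) (b := 0) (by grind)]
    · exact prod_entryWeight_eq_reversalWeight (by grind)
  · grind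
  · grind [Set.InjOn]
  · simp
  · intro k l π hπ
    simp only [avoids_triple, contains_p132, contains_p213, contains_p231, Fin.lt_def, hπ]
    grind

lemma weightSum_succ_123_213_231 :
    weightSum {p123, p213, p231} (n + 1) (entryWeight x q r) =
      ∑ kl ∈ antidiagonal n,
        if kl.1 ≤ kl.2 then entryWeight x q r kl.1 0 * reversalWeight x q r (kl.1 + kl.2)
        else reversalWeight x q r (kl.1 + kl.2 + 1) := by
  rw [weightSum_succ_eq_sum_antidiagonal (by simp) (by simp) (by simp)
    (f := fun k l i => if i < k then k + l - i else if i = k then 0 else k + l + 1 - i)]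
  · refine sum_congr rfl fun ⟨k, l⟩ hkl => ?_
    obtain rfl : k + l = n := mem_antidiagonal.1 hkl
    split_ifs with hle
    · rw [add_right_comm, prod_range_add, prod_range_succ, mul_right_comm, mul_comm,
        reversalWeight, prod_range_add]
      congr! 3 with i hi i hi
      · simp
      all_goals
        rw [mem_range] at hi
        exact entryWeight_congr (by grind) (by grind)
    · exact prod_entryWeight_eq_reversalWeight (by grind)
  · grind
  · grind [Set.InjOn]
  · simp
  · intro k l π hπ
    simp only [avoids_triple, contains_p123, contains_p213, contains_p231, Fin.lt_def, hπ]
    grind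

end MinimumPositionClasses

section Series

open PowerSeries

variable {A : Type*} [CommRing A]

lemma mk_mul_of_recurrence {f : ℕ → A} {a b : A} (hf : ∀ n, f (n + 2) = a * f (n + 1) + b * f n) :
    mk f * (1 - C a * X - C b * X ^ 2) = C (f 0) + C (f 1 - a * f 0) * X := by
  have h₁ : mk f = X * mk (fun n => f (n + 1)) + C (f 0) := by
    simpa using eq_X_mul_shift_add_const (mk f)
  have h₂ : mk (fun n => f (n + 1)) = X * mk (fun n => f (n + 2)) + C (f 1) := by
    simpa using eq_X_mul_shift_add_const (mk fun n => f (n + 1))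
  have h₃ : mk (fun n => f (n + 2)) = C a * mk (fun n => f (n + 1)) + C b * mk f := by
    ext n
    simp [hf]
  rw [map_sub, map_mul]
  linear_combination (1 - C a * X) * h₁ + X * h₂ + X ^ 2 * h₃

lemma mk_pow_mul (a : A) : mk (fun n => a ^ n) * (1 - C a * X) = 1 := by
  simpa using mk_mul_of_recurrence (f := fun n => a ^ n) (a := a) (b := 0) fun n => by ring

lemma X_mul_mk_pow_succ (a : A) : X * mk (fun n => a ^ (n + 1)) = mk (fun n => a ^ n) - 1 := by
  simpa [eq_sub_iff_add_eq] using (eq_X_mul_shift_add_const (mk fun n => a ^ n)).symm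

/-- The hypothesis makes every diagonal of `h` a geometric progression, so that `h` is determined
by its values on the axes. -/
lemma mk_sum_antidiagonal_mul {h : ℕ → ℕ → A} {y : A}
    (hh : ∀ k l, h (k + 1) (l + 1) = y * h k l) :
    mk (fun n => ∑ kl ∈ antidiagonal n, h kl.1 kl.2) * (1 - C y * X ^ 2) =
      mk (h 0) + X * mk fun k => h (k + 1) 0 := by
  ext n
  rw [mul_sub, mul_one, mul_left_comm, map_sub, map_add, coeff_C_mul, coeff_mul_X_pow', coeff_mk,
    coeff_mk]
  match n with
  | 0 => simp
  | 1 => simp [Nat.antidiagonal_succ]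
  | n + 2 =>
    rw [Nat.sum_antidiagonal_succ', Nat.sum_antidiagonal_succ]
    simp only [hh, mul_sum, coeff_mk, coeff_succ_X_mul, le_add_iff_nonneg_left, zero_le, if_true,
      Nat.add_sub_cancel]
    ring

lemma sum_antidiagonal_sub_sum_antidiagonal {B : Type*} [AddCommGroup B] {f g : ℕ → ℕ → B}
    (hfg : ∀ k l, f (k + 1) l = g (k + 1) l) (n : ℕ) :
    ∑ kl ∈ antidiagonal n, f kl.1 kl.2 - ∑ kl ∈ antidiagonal n, g kl.1 kl.2 = f 0 n - g 0 n := by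
  cases n <;> simp [Nat.antidiagonal_succ, hfg]

variable (x q r : A)

lemma mk_reversalWeight_mul :
    mk (reversalWeight x q r) * (1 - C (q * r) * X ^ 2) = 1 + C x * X := by
  have hrec (n : ℕ) : reversalWeight x q r (n + 2) =
      0 * reversalWeight x q r (n + 1) + q * r * reversalWeight x q r n := by
    rw [reversalWeight_add_two, zero_mul, zero_add]
  simpa [reversalWeight, entryWeight] using mk_mul_of_recurrence hrec

lemma X_mul_mk_reversalWeight_succ :
    X * mk (fun n => reversalWeight x q r (n + 1)) = mk (reversalWeight x q r) - 1 := by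
  simpa [eq_sub_iff_add_eq, reversalWeight] using
    (eq_X_mul_shift_add_const (mk (reversalWeight x q r))).symm

lemma mk_reversalWeight_add_two {A : Type*} [CommSemiring A] (x q r : A) :
    mk (fun n => reversalWeight x q r (n + 2)) = C (q * r) * mk (reversalWeight x q r) := by
  ext n
  simp only [reversalWeight_add_two, coeff_mk, coeff_C_mul]

end Series

section MinimumPositionSeries

open PowerSeries

section CommSemiring

variable {A : Type*} [CommSemiring A] {x q r : A}

lemma genFun_eq_one_add {S : Set Pattern} (hS : ∀ p ∈ S, 0 < p.1) {f : ℕ → A}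
    (hf : ∀ n, weightSum S (n + 1) (entryWeight x q r) = f n) :
    genFun S x q r = 1 + X * mk f := by
  rw [genFun, eq_X_mul_shift_add_const (mk _)]
  simp [weightSum_zero hS, hf, add_comm]

lemma genFun_eq_one_add_mul {S : Set Pattern} (hS : ∀ p ∈ S, 0 < p.1) {f g : ℕ → A}
    (hfg : ∀ n, weightSum S (n + 1) (entryWeight x q r) =
      ∑ kl ∈ antidiagonal n, f kl.1 * g kl.2) :
    genFun S x q r = 1 + X * (mk f * mk g) := by
  rw [genFun_eq_one_add hS hfg]
  congr 2
  ext n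
  simp only [coeff_mul, coeff_mk]

end CommSemiring

variable {A : Type*} [CommRing A] (x q r : A)

lemma genFun_132_231_312 :
    genFun {p132, p231, p312} x q r * ((1 - C x * X) * (1 - C (q * r) * X ^ 2)) =
      1 + C (x * (q * r)) * X ^ 3 := by
  have hrev := mk_reversalWeight_mul x q r
  have hshift := X_mul_mk_reversalWeight_succ x q r
  have hgeom := mk_pow_mul x
  rw [genFun_eq_one_add_mul (f := fun k => reversalWeight x q r (k + 1)) (g := fun l => x ^ l)
    (by simp [p132, p231, p312]) (weightSum_succ_132_231_312 x q r), map_mul C x]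
  linear_combination mk (fun n => x ^ n) * (1 - C x * X) * (1 - C (q * r) * X ^ 2) * hshift +
    (mk (reversalWeight x q r) - 1) * (1 - C (q * r) * X ^ 2) * hgeom + hrev

lemma genFun_123_231_312 :
    genFun {p123, p231, p312} x q r * (1 - C (q * r) * X ^ 2) ^ 2 =
      (1 - C (q * r) * X ^ 2) ^ 2 + (1 + C x * X) * (C x * X + C (q * r) * X ^ 2) := by
  have hrev := mk_reversalWeight_mul x q r
  have hshift := X_mul_mk_reversalWeight_succ x q r
  rw [genFun_eq_one_add_mul (f := fun k => reversalWeight x q r (k + 1)) (g := reversalWeight x q r)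
    (by simp [p123, p231, p312]) (weightSum_succ_123_231_312 x q r)]
  linear_combination mk (reversalWeight x q r) * (1 - C (q * r) * X ^ 2) ^ 2 * hshift +
    ((mk (reversalWeight x q r) - 1) * (1 - C (q * r) * X ^ 2) + 1 + C x * X) * hrev

lemma genFun_132_312_321 :
    genFun {p132, p312, p321} x q r * ((1 - C x * X) * (1 - C q * X)) =
      1 - C q * X + C (q * r) * X ^ 2 := by
  have hexc : mk (fun k => q ^ k * entryWeight x q r k 0) * (1 - C q * X) =
      C x + C (q * r - q * x) * X := by
    simpa [entryWeight] using mk_mul_of_recurrence (f := fun k => q ^ k * entryWeight x q r k 0)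
      (a := q) (b := 0) fun n => by simp [entryWeight, pow_succ']; ring
  have hgeom := mk_pow_mul x
  rw [genFun_eq_one_add_mul (f := fun k => q ^ k * entryWeight x q r k 0) (g := fun l => x ^ l)
    (by simp [p132, p312, p321]) (weightSum_succ_132_312_321 x q r)]
  rw [map_sub, map_mul C q x] at hexc
  linear_combination X * mk (fun n => x ^ n) * (1 - C x * X) * hexc +
    X * (C x + (C (q * r) - C q * C x) * X) * hgeom

lemma genFun_132_213_321 :
    genFun {p132, p213, p321} x q r * ((1 - C x * X) * (1 - C q * X) * (1 - C r * X)) =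
      1 - (C q + C r) * X + 2 * C (q * r) * X ^ 2 - C (x * (q * r)) * X ^ 3 := by
  have hgen : genFun {p132, p213, p321} x q r =
      1 + X * (mk (fun n => q ^ n) * mk (fun n => r ^ (n + 1)) + mk (fun n => x ^ (n + 1)) -
        mk fun n => r ^ (n + 1)) := by
    rw [genFun_eq_one_add (by simp [p132, p213, p321]) (weightSum_succ_132_213_321 x q r)]
    congr 2
    ext n
    have hsplit := sum_antidiagonal_sub_sum_antidiagonal
      (f := fun k l => q ^ k * entryWeight x q r k 0 ^ (l + 1))
      (g := fun k l => q ^ k * r ^ (l + 1)) (by simp [entryWeight]) n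
    simp only [entryWeight_of_eq, pow_zero, one_mul] at hsplit
    simp only [map_sub, map_add, coeff_mul, coeff_mk]
    linear_combination hsplit
  have hx := mk_pow_mul x
  have hq := mk_pow_mul q
  have hr := mk_pow_mul r
  have hx' := X_mul_mk_pow_succ x
  have hr' := X_mul_mk_pow_succ r
  rw [hgen, map_mul C x, map_mul]
  linear_combination
    (1 - C x * X) * (1 - C q * X) * (1 - C r * X) * ((mk fun n => q ^ n) * hr' + hx' - hr') +
    (1 - C q * X) * (1 - C r * X) * hx - (1 - C x * X) * (1 - C q * X) * hr +
    (1 - C x * X) * (1 - C q * X) * mk (fun n => q ^ n) * hr +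
    (1 - C x * X) * (C r * X) * hq

lemma mk_sum_ite_pow_mul_pow_reversalWeight_mul :
    mk (fun n => ∑ kl ∈ antidiagonal n, if kl.1 ≤ kl.2 + 1 then q ^ kl.1 * r ^ (kl.2 + 1)
        else reversalWeight x q r (kl.1 + kl.2 + 1)) * (1 - C (q * r) * X ^ 2) =
      mk (fun n => r ^ (n + 1)) + X * (C (q * r) * mk (reversalWeight x q r)) := by
  let h (k l : ℕ) : A :=
    if k ≤ l + 1 then q ^ k * r ^ (l + 1) else reversalWeight x q r (k + l + 1)
  rw [← mk_reversalWeight_add_two, mk_sum_antidiagonal_mul (h := h)]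
  · congr 2
    · ext n
      simp [h]
    · ext k
      cases k <;> simp [h, reversalWeight, prod_range_succ, entryWeight]
  · intro k l
    simp only [h, add_le_add_iff_right, mul_ite, ← reversalWeight_add_two]
    ring_nf

lemma genFun_132_213_231 :
    genFun {p132, p213, p231} x q r *
        ((1 - C x * X) * (1 - C r * X) * (1 - C (q * r) * X ^ 2) ^ 2) =
      (1 - C r * X) * (1 - C (q * r) * X ^ 2) ^ 2 + C (q * r) * X ^ 2 * (1 - C x * X) *
        (1 - C (q * r) * X ^ 2 + (1 - C r * X) * (C x * X + C (q * r) * X ^ 2)) := by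
  let h (k l : ℕ) : A :=
    if k ≤ l + 1 then q ^ k * r ^ (l + 1) else reversalWeight x q r (k + l + 1)
  have hgen : genFun {p132, p213, p231} x q r =
      1 + X * (mk (fun n => ∑ kl ∈ antidiagonal n, h kl.1 kl.2) + mk (fun n => x ^ (n + 1)) -
        mk fun n => r ^ (n + 1)) := by
    rw [genFun_eq_one_add (by simp [p132, p213, p231]) (weightSum_succ_132_213_231 x q r)]
    congr 2
    ext n
    have hsplit := sum_antidiagonal_sub_sum_antidiagonal (g := h)
      (f := fun k l => if k ≤ l + 1 then q ^ k * entryWeight x q r k 0 ^ (l + 1)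
        else reversalWeight x q r (k + l + 1)) (by simp [h, entryWeight]) n
    simp only [h, entryWeight_of_eq, zero_le, if_true, pow_zero, one_mul] at hsplit
    simp only [map_sub, map_add, coeff_mk]
    linear_combination hsplit
  have hsum := mk_sum_ite_pow_mul_pow_reversalWeight_mul x q r
  have hrev := mk_reversalWeight_mul x q r
  have hx := mk_pow_mul x
  have hr := mk_pow_mul r
  have hx' := X_mul_mk_pow_succ x
  have hr' := X_mul_mk_pow_succ r
  rw [hgen]
  set a := 1 - C x * X
  set b := 1 - C (q * r) * X ^ 2
  set c := 1 - C r * X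
  linear_combination a * c * b * X * hsum + a * c * b * hr' + a * c * b ^ 2 * (hx' - hr') +
    c * b ^ 2 * hx + a * b * (1 - b) * hr + C (q * r) * X ^ 2 * a * c * hrev

lemma genFun_123_213_231 :
    genFun {p123, p213, p231} x q r * (1 - C (q * r) * X ^ 2) ^ 2 =
      (1 - C (q * r) * X ^ 2) ^ 2 + X * (1 + C x * X) *
        ((C x - C r) * (1 - C (q * r) * X ^ 2) + C r + C (q * r) * X) := by
  let h (k l : ℕ) : A :=
    if k ≤ l then r * reversalWeight x q r (k + l) else reversalWeight x q r (k + l + 1)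
  have hgen : genFun {p123, p213, p231} x q r =
      1 + X * (mk (fun n => ∑ kl ∈ antidiagonal n, h kl.1 kl.2) +
        (C x - C r) * mk (reversalWeight x q r)) := by
    rw [genFun_eq_one_add (by simp [p123, p213, p231]) (weightSum_succ_123_213_231 x q r)]
    congr 2
    ext n
    have hsplit := sum_antidiagonal_sub_sum_antidiagonal (g := h)
      (f := fun k l => if k ≤ l then entryWeight x q r k 0 * reversalWeight x q r (k + l)
        else reversalWeight x q r (k + l + 1)) (by simp [h, entryWeight]) n
    simp only [h, entryWeight_of_eq, zero_le, if_true, zero_add] at hsplit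
    simp only [map_add, ← map_sub C, coeff_C_mul, coeff_mk]
    linear_combination hsplit
  have hsum : mk (fun n => ∑ kl ∈ antidiagonal n, h kl.1 kl.2) * (1 - C (q * r) * X ^ 2) =
      C r * mk (reversalWeight x q r) + X * (C (q * r) * mk (reversalWeight x q r)) := by
    rw [← mk_reversalWeight_add_two, mk_sum_antidiagonal_mul]
    · congr 1
      ext n
      simp [h]
    · intro k l
      simp only [h, add_le_add_iff_right, show k + 1 + (l + 1) = k + l + 2 by ring,
        show k + l + 2 + 1 = k + l + 1 + 2 by ring, reversalWeight_add_two, mul_ite]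
      rw [mul_left_comm]
  have hrev := mk_reversalWeight_mul x q r
  rw [hgen]
  set b := 1 - C (q * r) * X ^ 2
  linear_combination X * b * hsum +
    X * (C r + C (q * r) * X + (C x - C r) * b) * hrev

end MinimumPositionSeries

section Layered

lemma avoids_231_312_321_iff {n : ℕ} {π : Perm (Fin n)} :
    Avoids π {p231, p312, p321} ↔ ∀ i j : Fin n, (i : ℕ) + 1 < j → π i < π j := by
  simp only [avoids_triple, contains_p231, contains_p312, contains_p321, not_exists]
  constructor
  · rintro ⟨h231, h312, h321⟩ i j hij
    by_contra! hji
    let k : Fin n := ⟨i + 1, by omega⟩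
    have hik : i < k := Fin.lt_def.2 (Nat.lt_succ_self i)
    have hkj : k < j := hij
    have hji' : π j < π i := hji.lt_of_ne (π.injective.ne (hik.trans hkj).ne')
    have hk : π i ≠ π k := π.injective.ne hik.ne
    have hk' : π j ≠ π k := π.injective.ne hkj.ne'
    grind
  · intro h
    refine ⟨?_, ?_, ?_⟩
    all_goals
      rintro a b c ⟨hab, hbc, hπ⟩
      have := h a c (by grind)
      grind

/-- The direct sum of `1` and `e`. -/
def oneSum {n : ℕ} (e : Perm (Fin n)) : Perm (Fin (n + 1)) := Equiv.Perm.decomposeFin.symm (0, e)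

/-- The direct sum of `21` and `e`. -/
def twoOneSum {n : ℕ} (e : Perm (Fin n)) : Perm (Fin (n + 2)) :=
  Equiv.Perm.decomposeFin.symm (1, oneSum e)

section DirectSum

variable {n : ℕ} (e : Perm (Fin n))

lemma oneSum_zero : oneSum e 0 = 0 := by
  simp [oneSum]

lemma oneSum_succ (i : Fin n) : oneSum e i.succ = (e i).succ := by
  simp [oneSum]

lemma twoOneSum_zero : twoOneSum e 0 = 1 := by
  simp [twoOneSum]

lemma twoOneSum_one : twoOneSum e 1 = 0 := by
  simp [twoOneSum, Equiv.Perm.decomposeFin_symm_apply_one, oneSum_zero]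

lemma twoOneSum_succ_succ (i : Fin n) : twoOneSum e i.succ.succ = (e i).succ.succ := by
  rw [twoOneSum, Equiv.Perm.decomposeFin_symm_apply_succ, oneSum_succ]
  exact Equiv.swap_apply_of_ne_of_ne (Fin.succ_ne_zero _) (Fin.succ_succ_ne_one _)

lemma oneSum_injective : Function.Injective (oneSum (n := n)) := fun e f h => by
  simpa [oneSum] using h

lemma twoOneSum_injective : Function.Injective (twoOneSum (n := n)) := fun e f h =>
  oneSum_injective (by simpa [twoOneSum] using h)

lemma exists_oneSum_eq {π : Perm (Fin (n + 1))} (h : π 0 = 0) : ∃ e, oneSum e = π := by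
  obtain ⟨⟨p, e⟩, rfl⟩ := Equiv.Perm.decomposeFin.symm.surjective π
  obtain rfl : p = 0 := by simpa using h
  exact ⟨e, rfl⟩

lemma exists_twoOneSum_eq {π : Perm (Fin (n + 2))} (h₀ : π 0 = 1) (h₁ : π 1 = 0) :
    ∃ e, twoOneSum e = π := by
  obtain ⟨⟨p, e⟩, rfl⟩ := Equiv.Perm.decomposeFin.symm.surjective π
  obtain rfl : p = 1 := by simpa using h₀
  rw [Equiv.Perm.decomposeFin_symm_apply_one, Equiv.swap_apply_eq_iff, Equiv.swap_apply_left,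
    ← Fin.succ_zero_eq_one, Fin.succ_inj] at h₁
  obtain ⟨f, rfl⟩ := exists_oneSum_eq h₁
  exact ⟨f, rfl⟩

lemma avoids_oneSum_iff : Avoids (oneSum e) {p231, p312, p321} ↔ Avoids e {p231, p312, p321} := by
  simp [avoids_231_312_321_iff, Fin.forall_fin_succ, oneSum_zero, oneSum_succ]

lemma avoids_twoOneSum_iff :
    Avoids (twoOneSum e) {p231, p312, p321} ↔ Avoids e {p231, p312, p321} := by
  simp [avoids_231_312_321_iff, Fin.forall_fin_succ, twoOneSum_zero, twoOneSum_one,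
    twoOneSum_succ_succ, Fin.one_lt_succ_succ]

lemma Avoids.apply_zero_eq_one {π : Perm (Fin (n + 2))} (hπ : Avoids π {p231, p312, p321})
    (h : π 0 ≠ 0) : π 0 = 1 ∧ π 1 = 0 := by
  rw [avoids_231_312_321_iff] at hπ
  have eq_zero_or_one {k : Fin (n + 2)} (hk : π k ≤ π 0) : k = 0 ∨ k = 1 := by
    by_contra! hne
    refine hk.not_gt (hπ 0 k ?_)
    simp only [ne_eq, Fin.ext_iff, Fin.val_zero, Fin.val_one] at hne ⊢
    omega
  have hπ₁ : π 1 = 0 := by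
    obtain ⟨i, hi⟩ := π.surjective 0
    rcases eq_zero_or_one (by simp [hi] : π i ≤ π 0) with rfl | rfl
    exacts [absurd hi h, hi]
  obtain ⟨j, hj⟩ := π.surjective 1
  rcases eq_zero_or_one (hj ▸ Fin.one_le_of_ne_zero h : π j ≤ π 0) with rfl | rfl
  · exact ⟨hj, hπ₁⟩
  · simp [hπ₁] at hj

end DirectSum

variable {A : Type*} [CommSemiring A]

lemma weightSum_231_312_321_one (w : ℕ → ℕ → A) : weightSum {p231, p312, p321} 1 w = w 0 0 := by
  have havoids (π : Perm (Fin 1)) : Avoids π {p231, p312, p321} :=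
    avoids_231_312_321_iff.2 (by simp)
  simp [weightSum, havoids]

lemma weightSum_231_312_321_add_two (n : ℕ) (w : ℕ → ℕ → A) :
    weightSum {p231, p312, p321} (n + 2) w =
      w 0 0 * weightSum {p231, p312, p321} (n + 1) (fun i j => w (i + 1) (j + 1)) +
      w 0 1 * w 1 0 * weightSum {p231, p312, p321} n (fun i j => w (i + 2) (j + 2)) := by
  classical
  rw [weightSum, ← sum_filter_add_sum_filter_not _ fun π => π 0 = 0]
  simp only [weightSum, mul_sum]
  congr 1
  · symm
    refine sum_nbij oneSum ?_ oneSum_injective.injOn ?_ fun e _ => ?_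
    · simp [avoids_oneSum_iff, oneSum_zero]
    · intro π hπ
      obtain ⟨hπ, hπ₀⟩ : Avoids π {p231, p312, p321} ∧ π 0 = 0 := by simpa using hπ
      obtain ⟨e, rfl⟩ := exists_oneSum_eq hπ₀
      exact ⟨e, by simpa using (avoids_oneSum_iff e).1 hπ, rfl⟩
    · simp [Fin.prod_univ_succ, oneSum_zero, oneSum_succ]
  · symm
    refine sum_nbij twoOneSum ?_ twoOneSum_injective.injOn ?_ fun e _ => ?_
    · simp [avoids_twoOneSum_iff, twoOneSum_zero]
    · intro π hπ
      obtain ⟨hπ, hπ₀⟩ : Avoids π {p231, p312, p321} ∧ π 0 ≠ 0 := by simpa using hπ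
      obtain ⟨h₀, h₁⟩ := hπ.apply_zero_eq_one hπ₀
      obtain ⟨e, rfl⟩ := exists_twoOneSum_eq h₀ h₁
      exact ⟨e, by simpa using (avoids_twoOneSum_iff e).1 hπ, rfl⟩
    · simp [Fin.prod_univ_succ, twoOneSum_zero, twoOneSum_one, twoOneSum_succ_succ, mul_assoc]

open PowerSeries in
lemma genFun_231_312_321 {A : Type*} [CommRing A] (x q r : A) :
    genFun {p231, p312, p321} x q r * (1 - C x * X - C (q * r) * X ^ 2) = 1 := by
  have hshift (m : ℕ) : (fun i j => entryWeight x q r (i + m) (j + m)) = entryWeight x q r := by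
    ext i j
    exact entryWeight_congr (by omega) (by omega)
  rw [genFun, mk_mul_of_recurrence]
  · rw [weightSum_zero (by simp [p231, p312, p321]), weightSum_231_312_321_one]
    simp [entryWeight]
  · intro n
    rw [weightSum_231_312_321_add_two, hshift, hshift]
    simp [entryWeight]

end Layered

section ReverseLayered

section LayeredSum

variable {A : Type*} [CommSemiring A] {u : ℕ → A} {q r : A}

/-- The total weight of the permutations of length `n` that avoid `231`, `312` and `321`, placed
with their lower left corner at `(c, c)`, where the weight `u (i + j)` of a point `(i, j)` depends
only on its antidiagonal. -/
noncomputable def layeredSum (u : ℕ → A) (c n : ℕ) : A :=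
  weightSum {p231, p312, p321} n fun i j => u (2 * c + (i + j))

lemma layeredSum_zero (u : ℕ → A) (c : ℕ) : layeredSum u c 0 = 1 :=
  weightSum_zero (by simp [p231, p312, p321]) _

lemma layeredSum_one (u : ℕ → A) (c : ℕ) : layeredSum u c 1 = u (2 * c) :=
  weightSum_231_312_321_one _

lemma layeredSum_add_two (u : ℕ → A) (c n : ℕ) : layeredSum u c (n + 2) =
    u (2 * c) * layeredSum u (c + 1) (n + 1) + u (2 * c + 1) ^ 2 * layeredSum u (c + 2) n := by
  rw [layeredSum, weightSum_231_312_321_add_two, layeredSum, layeredSum, sq]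
  congr 4 <;> (ext i j; congr 1; ring)

lemma layeredSum_of_forall_eq {c : ℕ} (n : ℕ) (hu : ∀ k, 2 * c ≤ k → u k = r) :
    layeredSum u c n = r ^ n * Nat.fib (n + 1) := by
  induction n using Nat.twoStepInduction generalizing c with
  | zero => simp [layeredSum_zero]
  | one => simp [layeredSum_one, hu]
  | more n ih₀ ih₁ =>
    rw [layeredSum_add_two, ih₁ fun k hk => hu k (by omega), ih₀ fun k hk => hu k (by omega),
      hu _ le_rfl, hu _ (Nat.le_succ _), Nat.fib_add_two (n := n + 1)]
    push_cast
    ring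

/-- The two summands correspond to whether a layer begins at position `j` or straddles it. -/
lemma layeredSum_add_of_forall_eq (j m : ℕ) (hu : ∀ k < 2 * j, u k = q) :
    layeredSum u 0 (j + m + 1) = q ^ j * (Nat.fib (j + 1) * layeredSum u j (m + 1) +
      q * Nat.fib j * layeredSum u (j + 1) m) := by
  induction j generalizing m with
  | zero => simp
  | succ j ih =>
    rw [add_right_comm j 1 m, add_assoc j m 1, ih (m + 1) fun k hk => hu k (by omega),
      layeredSum_add_two, hu (2 * j) (by omega), hu (2 * j + 1) (by omega),
      Nat.fib_add_two (n := j)]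
    push_cast
    ring

variable {x : A}

lemma weightSum_succ_123_132_213 (n : ℕ) :
    weightSum {p123, p132, p213} (n + 1) (entryWeight x q r) =
      layeredSum (fun k => entryWeight x q r k n) 0 (n + 1) := by
  have himage : PatternSymmetry.compl.map '' {p231, p312, p321} = {p123, p132, p213} := by
    rw [PatternSymmetry.image_map_triple, PatternSymmetry.map_compl_p231,
      PatternSymmetry.map_compl_p312, PatternSymmetry.map_compl_p321, Set.insert_comm,
      Set.pair_comm, Set.insert_comm]
  rw [← himage, weightSum_image_map_compl]
  exact weightSum_congr fun i _ j hj => entryWeight_congr (by omega) (by omega)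

lemma weightSum_two_mul_add_one_123_132_213 (p : ℕ) :
    weightSum {p123, p132, p213} (2 * p + 1) (entryWeight x q r) =
      (q * r) ^ p * (x * Nat.fib (p + 1) ^ 2 + (q + r) * (Nat.fib p * Nat.fib (p + 1))) := by
  have hright {c : ℕ} (hc : p < c) (n : ℕ) := layeredSum_of_forall_eq (c := c) n
    fun k hk => (entryWeight_of_gt (by omega) : entryWeight x q r k (2 * p) = r)
  rw [weightSum_succ_123_132_213, two_mul p, layeredSum_add_of_forall_eq (q := q) p p fun k hk =>
    entryWeight_of_lt (by omega), ← two_mul, hright (Nat.lt_succ_self p)]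
  rcases p with _ | p
  · simp [layeredSum_one, entryWeight_of_eq]
  · rw [layeredSum_add_two, hright (by omega), hright (by omega), entryWeight_of_eq rfl,
      entryWeight_of_gt (by omega)]
    ring

lemma weightSum_two_mul_add_two_123_132_213 (p : ℕ) :
    weightSum {p123, p132, p213} (2 * p + 2) (entryWeight x q r) =
      (q * r) ^ (p + 1) * Nat.fib (p + 2) ^ 2 + x ^ 2 * ((q * r) ^ p * Nat.fib (p + 1) ^ 2) := by
  have hright {c : ℕ} (hc : p < c) (n : ℕ) := layeredSum_of_forall_eq (c := c) n
    fun k hk => (entryWeight_of_gt (by omega) : entryWeight x q r k (2 * p + 1) = r)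
  rw [weightSum_succ_123_132_213, show 2 * p + 1 + 1 = p + (p + 1) + 1 by ring,
    layeredSum_add_of_forall_eq (q := q) p (p + 1) fun k hk => entryWeight_of_lt (by omega),
    layeredSum_add_two, hright (by omega), hright (by omega),
    entryWeight_of_lt (by omega), entryWeight_of_eq rfl, Nat.fib_add_two (n := p)]
  push_cast
  ring

end LayeredSum

section LayeredSeries

open PowerSeries

variable {A : Type*} [CommRing A]

lemma mk_eq_expand_two_add_X_mul_expand_two (f : ℕ → A) :
    mk f = expand 2 two_ne_zero (mk fun n => f (2 * n)) +
      X * expand 2 two_ne_zero (mk fun n => f (2 * n + 1)) := by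
  ext n
  have hodd (p : ℕ) : ¬ 2 ∣ 2 * p + 1 := by omega
  rcases n.even_or_odd' with ⟨p, rfl | rfl⟩
  · rcases p with _ | p
    · simp
    · rw [map_add, coeff_expand_mul, coeff_mk, coeff_mk, Nat.mul_succ, coeff_succ_X_mul,
        coeff_expand_of_not_dvd _ _ _ (hodd p), add_zero]
  · simp only [map_add, coeff_expand_of_not_dvd _ _ _ (hodd p), coeff_succ_X_mul,
      coeff_expand_mul, coeff_mk, zero_add]

section CommSemiring

variable {A : Type*} [CommSemiring A]

/-- The generating function of the products of consecutive Fibonacci numbers, with `z` replaced by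
`a * z`. -/
noncomputable def fibMulSeries (a : A) : A⟦X⟧ := mk fun n => a ^ n * (Nat.fib n * Nat.fib (n + 1))

/-- The generating function of the squares of the Fibonacci numbers from `Nat.fib 1` on, with `z`
replaced by `a * z`. -/
noncomputable def fibSqSeries (a : A) : A⟦X⟧ := mk fun n => a ^ n * Nat.fib (n + 1) ^ 2

lemma fibMulSeries_eq (a : A) :
    fibMulSeries a = C a * X * (fibSqSeries a + fibMulSeries a) := by
  ext n
  rcases n with _ | n
  · simp [fibMulSeries, mul_assoc]
  · simp only [fibMulSeries, fibSqSeries, mul_assoc, coeff_C_mul, coeff_succ_X_mul, map_add,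
      coeff_mk, Nat.fib_add_two (n := n)]
    push_cast
    ring

lemma fibSqSeries_eq (a : A) :
    fibSqSeries a =
      1 + C a * X * (fibSqSeries a + 2 * fibMulSeries a + C a * X * fibSqSeries a) := by
  ext n
  rcases n with _ | _ | n
  · simp [fibSqSeries, mul_assoc]
  · simp [fibSqSeries, fibMulSeries, mul_assoc, two_mul]
  · simp only [fibMulSeries, fibSqSeries, mul_assoc, two_mul, coeff_C_mul, coeff_succ_X_mul,
      map_add, coeff_mk, coeff_one, Nat.fib_add_two (n := n + 1), Nat.fib_add_two (n := n)]
    push_cast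
    ring

end CommSemiring

lemma fibSqSeries_mul (a : A) :
    fibSqSeries a * ((1 + C a * X) * (1 - 3 * C a * X + C a ^ 2 * X ^ 2)) = 1 - C a * X := by
  linear_combination (1 - C a * X) * fibSqSeries_eq a + 2 * C a * X * fibMulSeries_eq a

lemma fibMulSeries_mul (a : A) :
    fibMulSeries a * ((1 + C a * X) * (1 - 3 * C a * X + C a ^ 2 * X ^ 2)) = C a * X := by
  linear_combination (1 - C a * X - C a ^ 2 * X ^ 2) * fibMulSeries_eq a +
    C a * X * fibSqSeries_eq a

variable (x q r : A)

lemma genFun_123_132_213_eq_expand :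
    genFun {p123, p132, p213} x q r =
      expand 2 two_ne_zero ((1 + C (x ^ 2) * X) * fibSqSeries (q * r)) +
        X * expand 2 two_ne_zero
          (C x * fibSqSeries (q * r) + C (q + r) * fibMulSeries (q * r)) := by
  rw [genFun, mk_eq_expand_two_add_X_mul_expand_two]
  congr 3
  · ext p
    rcases p with _ | p
    · simp [weightSum_zero, p123, p132, p213, fibSqSeries]
    · rw [coeff_mk, Nat.mul_succ, weightSum_two_mul_add_two_123_132_213, add_mul, one_mul, map_add,
        mul_assoc, coeff_C_mul, coeff_succ_X_mul, fibSqSeries, coeff_mk, coeff_mk]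
  · ext p
    rw [coeff_mk, weightSum_two_mul_add_one_123_132_213, map_add, coeff_C_mul, coeff_C_mul,
      fibSqSeries, fibMulSeries, coeff_mk, coeff_mk]
    ring

lemma genFun_123_132_213 :
    genFun {p123, p132, p213} x q r *
        ((1 + C (q * r) * X ^ 2) * (1 - 3 * C (q * r) * X ^ 2 + C (q * r) ^ 2 * X ^ 4)) =
      (1 - C (q * r) * X ^ 2) * (1 + C x * X + C (x ^ 2) * X ^ 2) +
        C (q + r) * C (q * r) * X ^ 3 := by
  have hsq := congrArg (expand 2 two_ne_zero) (fibSqSeries_mul (q * r))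
  have hmul := congrArg (expand 2 two_ne_zero) (fibMulSeries_mul (q * r))
  simp only [map_mul, map_add, map_sub, map_one, map_pow, map_ofNat, expand_C, expand_X] at hsq hmul
  rw [genFun_123_132_213_eq_expand]
  simp only [map_mul, map_add, map_pow, map_one, expand_C, expand_X]
  linear_combination (1 + C x * X + C x ^ 2 * X ^ 2) * hsq + (C q + C r) * X * hmul

end LayeredSeries

end ReverseLayered

section Finite

lemma contains_p123_or_contains_p321 {n : ℕ} (hn : 5 ≤ n) (π : Perm (Fin n)) :
    Contains π p123.2 ∨ Contains π p321.2 := by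
  by_contra! h
  simp only [contains_p123, contains_p321, not_exists, not_and] at h
  obtain ⟨h123, h321⟩ := h
  obtain ⟨a, b, c, d, e, hab, hbc, hcd, hde⟩ :
      ∃ a b c d e : Fin n, a < b ∧ b < c ∧ c < d ∧ d < e :=
    ⟨⟨0, by omega⟩, ⟨1, by omega⟩, ⟨2, by omega⟩, ⟨3, by omega⟩, ⟨4, by omega⟩, by simp⟩
  have hne {i j : Fin n} (hij : i < j) : π i ≠ π j := π.injective.ne hij.ne
  rcases (hne (hbc.trans hcd)).lt_or_gt with hbd | hdb
  · have hba : π b < π a := by grind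
    have hed : π e < π d := by grind
    have hbc' : π b < π c := by grind
    have hcd' : π c < π d := by grind
    exact h123 b c d hbc hcd hbc' hcd'
  · have hab' : π a < π b := by grind
    have hde' : π d < π e := by grind
    have hcb : π c < π b := by grind
    have hdc : π d < π c := by grind
    exact h321 b c d hbc hcd hdc hcb

section Statistics

variable {A : Type*} [CommSemiring A]

lemma weightSum_eq_zero_of_five_le {S : Set Pattern} (h123 : p123 ∈ S) (h321 : p321 ∈ S) {n : ℕ}
    (hn : 5 ≤ n) (w : ℕ → ℕ → A) : weightSum S n w = 0 := by
  classical
  refine sum_eq_zero fun π hπ => ?_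
  have havoids := (mem_filter.1 hπ).2
  exact absurd (contains_p123_or_contains_p321 hn π)
    (not_or_intro (havoids _ h123) (havoids _ h321))

instance {n m : ℕ} (π : Perm (Fin n)) (σ : Perm (Fin m)) : Decidable (Contains π σ) :=
  inferInstanceAs <| Decidable <| ∃ f : Fin m → Fin n, (∀ i j, i < j → f i < f j) ∧
    ∀ i j, π (f i) < π (f j) ↔ σ i < σ j

/-- The triples of the numbers of fixed points, excedances and anti-excedances of the permutations
of length `n` that avoid `p₁`, `p₂` and `p₃`. -/
def avoiderStatistics (p₁ p₂ p₃ : Pattern) (n : ℕ) : Multiset (ℕ × ℕ × ℕ) :=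
  ({π : Perm (Fin n) | ¬ Contains π p₁.2 ∧ ¬ Contains π p₂.2 ∧ ¬ Contains π p₃.2} :
    Finset (Perm (Fin n))).val.map fun π => (fp π, exc π, antiexc π)

lemma weightSum_eq_sum_avoiderStatistics (p₁ p₂ p₃ : Pattern) (n : ℕ) (x q r : A) :
    weightSum {p₁, p₂, p₃} n (entryWeight x q r) =
      ((avoiderStatistics p₁ p₂ p₃ n).map fun s => x ^ s.1 * q ^ s.2.1 * r ^ s.2.2).sum := by
  simp only [weightSum, avoids_triple, prod_entryWeight, avoiderStatistics, Multiset.map_map]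
  congr!

open PowerSeries

lemma mk_eq_of_forall_five_le {f : ℕ → A} (hf : ∀ n, 5 ≤ n → f n = 0) :
    PowerSeries.mk f =
      C (f 0) + C (f 1) * X + C (f 2) * X ^ 2 + C (f 3) * X ^ 3 + C (f 4) * X ^ 4 := by
  ext n
  rcases lt_or_ge n 5 with hn | hn
  · interval_cases n <;> simp [coeff_X_pow, coeff_C]
  · have (i : ℕ) (hi : i < 5) : n ≠ i := by omega
    simp [coeff_X_pow, coeff_X, coeff_C, hf n hn, this]

lemma genFun_123_132_321 (x q r : A) :
    genFun {p123, p132, p321} x q r =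
      1 + C x * X + (C x ^ 2 + C q * C r) * X ^ 2 +
        (C x * C q * C r + C q ^ 2 * C r + C q * C r ^ 2) * X ^ 3 +
        C q ^ 2 * C r ^ 2 * X ^ 4 := by
  rw [genFun, mk_eq_of_forall_five_le fun n hn =>
    weightSum_eq_zero_of_five_le (by simp) (by simp) hn _]
  simp only [weightSum_eq_sum_avoiderStatistics]
  rw [show avoiderStatistics _ _ _ 0 = {(0, 0, 0)} by decide +kernel,
    show avoiderStatistics _ _ _ 1 = {(1, 0, 0)} by decide +kernel,
    show avoiderStatistics _ _ _ 2 = {(2, 0, 0), (0, 1, 1)} by decide +kernel,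
    show avoiderStatistics _ _ _ 3 = {(1, 1, 1), (0, 2, 1), (0, 1, 2)} by decide +kernel,
    show avoiderStatistics _ _ _ 4 = {(0, 2, 2)} by decide +kernel]
  simp only [Multiset.insert_eq_cons, Multiset.map_cons, Multiset.map_singleton, Multiset.sum_cons,
    Multiset.sum_singleton, map_add, map_mul, map_pow, map_one, pow_zero, pow_one, mul_one, one_mul]
  ring

lemma genFun_123_231_321 (x q r : A) :
    genFun {p123, p231, p321} x q r =
      1 + C x * X + (C x ^ 2 + C q * C r) * X ^ 2 +
        (2 * C x * C q * C r + C q * C r ^ 2) * X ^ 3 + C q ^ 2 * C r ^ 2 * X ^ 4 := by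
  rw [genFun, mk_eq_of_forall_five_le fun n hn =>
    weightSum_eq_zero_of_five_le (by simp) (by simp) hn _]
  simp only [weightSum_eq_sum_avoiderStatistics]
  rw [show avoiderStatistics _ _ _ 0 = {(0, 0, 0)} by decide +kernel,
    show avoiderStatistics _ _ _ 1 = {(1, 0, 0)} by decide +kernel,
    show avoiderStatistics _ _ _ 2 = {(2, 0, 0), (0, 1, 1)} by decide +kernel,
    show avoiderStatistics _ _ _ 3 = {(1, 1, 1), (1, 1, 1), (0, 1, 2)} by decide +kernel,
    show avoiderStatistics _ _ _ 4 = {(0, 2, 2)} by decide +kernel]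
  simp only [Multiset.insert_eq_cons, Multiset.map_cons, Multiset.map_singleton, Multiset.sum_cons,
    Multiset.sum_singleton, map_add, map_mul, map_pow, map_one, pow_zero, pow_one, mul_one, one_mul]
  ring

end Statistics

end Finite

section Classification

lemma mem_of_fst_eq_three {p : Pattern} (hp : p.1 = 3) :
    p ∈ ({p123, p132, p213, p231, p312, p321} : Finset Pattern) := by
  obtain ⟨k, σ⟩ := p
  obtain rfl : k = 3 := hp
  simp only [mem_insert, mem_singleton, p123, p132, p213, p231, p312, p321, Sigma.mk.injEq,
    heq_eq_eq, true_and]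
  revert σ
  decide +kernel

set_option synthInstance.maxSize 1000 in
lemma mem_of_ncard_eq_three {S : Set Pattern} (hS : ∀ p ∈ S, p.1 = 3) (hcard : S.ncard = 3) :
    S ∈ ({
        {p123, p132, p213},
        {p231, p312, p321},
        {p123, p132, p231},
        {p123, p213, p231},
        {p123, p132, p312},
        {p123, p213, p312},
        {p132, p231, p321},
        {p213, p231, p321},
        {p132, p312, p321},
        {p213, p312, p321},
        {p132, p213, p231},
        {p132, p213, p312},
        {p132, p231, p312},
        {p213, p231, p312},
        {p123, p231, p312},
        {p132, p213, p321},
        {p123, p132, p321},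
        {p123, p213, p321},
        {p123, p231, p321},
        {p123, p312, p321}} : Set (Set Pattern)) := by
  have hsub : S ⊆ ({p123, p132, p213, p231, p312, p321} : Finset Pattern) :=
    fun p hp => mem_of_fst_eq_three (hS p hp)
  obtain ⟨T, rfl⟩ := (finite_toSet _).subset hsub |>.exists_finset_coe
  rw [Set.ncard_coe_finset] at hcard
  have hT := mem_powersetCard.2 ⟨coe_subset.1 hsub, hcard⟩
  simp only [Set.mem_insert_iff, Set.mem_singleton_iff]
  simp only [← coe_singleton, ← coe_insert, coe_inj]
  clear hS hsub hcard
  revert T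
  decide +kernel

end Classification

section Formulas

open PatternSymmetry
open MvPolynomial (X)

lemma genFun_triple_map_inv {A : Type*} [CommSemiring A] (p₁ p₂ p₃ : Pattern) (x q r : A) :
    genFun {inv.map p₁, inv.map p₂, inv.map p₃} x q r = genFun {p₁, p₂, p₃} x r q := by
  rw [← image_map_triple, genFun_image_map_inv]

lemma F_triple_map_antitranspose (p₁ p₂ p₃ : Pattern) :
    F {antitranspose.map p₁, antitranspose.map p₂, antitranspose.map p₃} = F {p₁, p₂, p₃} := by
  rw [← image_map_triple, F_eq_genFun, F_eq_genFun, genFun_image_map_antitranspose]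

lemma F_123_213_231_eq_F_123_132_231 : F {p123, p213, p231} = F {p123, p132, p231} := by
  simpa only [map_antitranspose_p123, map_antitranspose_p132, map_antitranspose_p231] using
    F_triple_map_antitranspose p123 p132 p231

lemma F_123_213_312_eq_F_123_132_312 : F {p123, p213, p312} = F {p123, p132, p312} := by
  simpa only [map_antitranspose_p123, map_antitranspose_p132, map_antitranspose_p312] using
    F_triple_map_antitranspose p123 p132 p312

lemma F_213_231_321_eq_F_132_231_321 : F {p213, p231, p321} = F {p132, p231, p321} := by
  simpa only [map_antitranspose_p132, map_antitranspose_p231, map_antitranspose_p321] using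
    F_triple_map_antitranspose p132 p231 p321

lemma F_213_312_321_eq_F_132_312_321 : F {p213, p312, p321} = F {p132, p312, p321} := by
  simpa only [map_antitranspose_p132, map_antitranspose_p312, map_antitranspose_p321] using
    F_triple_map_antitranspose p132 p312 p321

lemma F_213_231_312_eq_F_132_231_312 : F {p213, p231, p312} = F {p132, p231, p312} := by
  simpa only [map_antitranspose_p132, map_antitranspose_p231, map_antitranspose_p312] using
    F_triple_map_antitranspose p132 p231 p312

lemma F_123_213_321_eq_F_123_132_321 : F {p123, p213, p321} = F {p123, p132, p321} := by
  simpa only [map_antitranspose_p123, map_antitranspose_p132, map_antitranspose_p321] using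
    F_triple_map_antitranspose p123 p132 p321

lemma eq_frac {f a b : Coeffs⟦X⟧} (hb : PowerSeries.constantCoeff b = 1) (h : f * b = a) :
    f = frac a b :=
  (Ring.eq_mul_inverse_iff_mul_eq _ _ _
    (PowerSeries.isUnit_iff_constantCoeff.2 (hb ▸ isUnit_one))).2 h

lemma F_123_132_213 : F {p123, p132, p213} =
    frac (1 + varX * varZ + (varX ^ 2 - varQ) * varZ ^ 2 +
        (-varX * varQ + varQ ^ 2 + varQ) * varZ ^ 3 - varX ^ 2 * varQ * varZ ^ 4)
      ((1 + varQ * varZ ^ 2) * (1 - 3 * varQ * varZ ^ 2 + varQ ^ 2 * varZ ^ 4)) := by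
  have h := genFun_123_132_213 (X 0 : Coeffs) (X 1) 1
  simp only [← F_eq_genFun, map_mul, map_add, map_pow, map_one] at h
  refine eq_frac (by simp [varZ]) ?_
  simp only [varX, varQ, varZ]
  linear_combination h

lemma F_231_312_321 : F {p231, p312, p321} =
    frac 1 (1 - varX * varZ - varQ * varZ ^ 2) := by
  have h := genFun_231_312_321 (X 0 : Coeffs) (X 1) 1
  simp only [← F_eq_genFun, map_mul, map_one] at h
  refine eq_frac (by simp [varZ]) ?_
  simp only [varX, varQ, varZ]
  linear_combination h

lemma F_123_213_231 : F {p123, p213, p231} =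
    frac (1 + varX * varZ + (varX ^ 2 - varQ) * varZ ^ 2 + varQ * varZ ^ 3 +
        (-varX ^ 2 * varQ + varX * varQ + varQ ^ 2) * varZ ^ 4)
      ((1 - varQ * varZ ^ 2) ^ 2) := by
  have h := genFun_123_213_231 (X 0 : Coeffs) (X 1) 1
  simp only [← F_eq_genFun, map_mul, map_one] at h
  refine eq_frac (by simp [varZ]) ?_
  simp only [varX, varQ, varZ]
  linear_combination h

lemma F_123_213_312 : F {p123, p213, p312} =
    frac (1 + varX * varZ + (varX ^ 2 - varQ) * varZ ^ 2 + varQ ^ 2 * varZ ^ 3 +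
        (-varX ^ 2 * varQ + varX * varQ ^ 2 + varQ ^ 2) * varZ ^ 4)
      ((1 - varQ * varZ ^ 2) ^ 2) := by
  have h := genFun_123_213_231 (X 0 : Coeffs) 1 (X 1)
  rw [← genFun_triple_map_inv, map_inv_p123, map_inv_p213, map_inv_p231, ← F_eq_genFun] at h
  simp only [map_mul, map_one] at h
  refine eq_frac (by simp [varZ]) ?_
  simp only [varX, varQ, varZ]
  linear_combination h

lemma F_132_231_321 : F {p132, p231, p321} =
    frac (1 - varZ + varQ * varZ ^ 2) ((1 - varZ) * (1 - varX * varZ)) := by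
  have h := genFun_132_312_321 (X 0 : Coeffs) 1 (X 1)
  rw [← map_inv_p132, ← map_inv_p231, ← map_inv_p321, genFun_triple_map_inv, ← F_eq_genFun] at h
  simp only [map_mul, map_one] at h
  refine eq_frac (by simp [varZ]) ?_
  simp only [varX, varQ, varZ]
  linear_combination h

lemma F_132_312_321 : F {p132, p312, p321} =
    frac (1 - varQ * varZ + varQ * varZ ^ 2) ((1 - varX * varZ) * (1 - varQ * varZ)) := by
  have h := genFun_132_312_321 (X 0 : Coeffs) (X 1) 1
  simp only [← F_eq_genFun, map_mul, map_one] at h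
  refine eq_frac (by simp [varZ]) ?_
  simp only [varX, varQ, varZ]
  linear_combination h

lemma F_132_213_231 : F {p132, p213, p231} =
    frac (1 - varZ - varQ * varZ ^ 2 + 2 * varQ * varZ ^ 3 +
        (-varX ^ 2 * varQ + varQ ^ 2 - varX * varQ) * varZ ^ 4 +
        (varX ^ 2 * varQ - 2 * varQ ^ 2) * varZ ^ 5 + varX * varQ ^ 2 * varZ ^ 6)
      ((1 - varZ) * (1 - varX * varZ) * (1 - varQ * varZ ^ 2) ^ 2) := by
  have h := genFun_132_213_231 (X 0 : Coeffs) (X 1) 1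
  simp only [← F_eq_genFun, map_mul, map_one] at h
  refine eq_frac (by simp [varZ]) ?_
  simp only [varX, varQ, varZ]
  linear_combination h

lemma F_132_213_312 : F {p132, p213, p312} =
    frac (1 - varQ * varZ - varQ * varZ ^ 2 + 2 * varQ ^ 2 * varZ ^ 3 +
        (-varX ^ 2 * varQ - varX * varQ ^ 2 + varQ ^ 2) * varZ ^ 4 +
        (varX ^ 2 * varQ ^ 2 - 2 * varQ ^ 3) * varZ ^ 5 + varX * varQ ^ 3 * varZ ^ 6)
      ((1 - varX * varZ) * (1 - varQ * varZ) * (1 - varQ * varZ ^ 2) ^ 2) := by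
  have h := genFun_132_213_231 (X 0 : Coeffs) 1 (X 1)
  rw [← genFun_triple_map_inv, map_inv_p132, map_inv_p213, map_inv_p231, ← F_eq_genFun] at h
  simp only [map_mul, map_one] at h
  refine eq_frac (by simp [varZ]) ?_
  simp only [varX, varQ, varZ]
  linear_combination h

lemma F_132_231_312 : F {p132, p231, p312} =
    frac (1 + varX * varQ * varZ ^ 3) ((1 - varX * varZ) * (1 - varQ * varZ ^ 2)) := by
  have h := genFun_132_231_312 (X 0 : Coeffs) (X 1) 1
  simp only [← F_eq_genFun, map_mul, map_one] at h
  refine eq_frac (by simp [varZ]) ?_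
  simp only [varX, varQ, varZ]
  linear_combination h

lemma F_123_231_312 : F {p123, p231, p312} =
    frac (1 + varX * varZ + (varX ^ 2 - varQ) * varZ ^ 2 + varX * varQ * varZ ^ 3 +
        varQ ^ 2 * varZ ^ 4)
      ((1 - varQ * varZ ^ 2) ^ 2) := by
  have h := genFun_123_231_312 (X 0 : Coeffs) (X 1) 1
  simp only [← F_eq_genFun, map_mul, map_one] at h
  refine eq_frac (by simp [varZ]) ?_
  simp only [varX, varQ, varZ]
  linear_combination h

lemma F_132_213_321 : F {p132, p213, p321} =
    frac (1 - (1 + varQ) * varZ + 2 * varQ * varZ ^ 2 - varX * varQ * varZ ^ 3)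
      ((1 - varZ) * (1 - varX * varZ) * (1 - varQ * varZ)) := by
  have h := genFun_132_213_321 (X 0 : Coeffs) (X 1) 1
  simp only [← F_eq_genFun, map_mul, map_one] at h
  refine eq_frac (by simp [varZ]) ?_
  simp only [varX, varQ, varZ]
  linear_combination h

lemma F_123_132_321 : F {p123, p132, p321} =
    1 + varX * varZ + (varX ^ 2 + varQ) * varZ ^ 2 + (varX * varQ + varQ ^ 2 + varQ) * varZ ^ 3 +
      varQ ^ 2 * varZ ^ 4 := by
  have h := genFun_123_132_321 (X 0 : Coeffs) (X 1) 1
  simp only [← F_eq_genFun, map_one] at h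
  simp only [varX, varQ, varZ]
  linear_combination h

lemma F_123_231_321 : F {p123, p231, p321} =
    1 + varX * varZ + (varX ^ 2 + varQ) * varZ ^ 2 + (2 * varX * varQ + varQ) * varZ ^ 3 +
      varQ ^ 2 * varZ ^ 4 := by
  have h := genFun_123_231_321 (X 0 : Coeffs) (X 1) 1
  simp only [← F_eq_genFun, map_one] at h
  simp only [varX, varQ, varZ]
  linear_combination h

lemma F_123_312_321 : F {p123, p312, p321} =
    1 + varX * varZ + (varX ^ 2 + varQ) * varZ ^ 2 + (2 * varX * varQ + varQ ^ 2) * varZ ^ 3 +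
      varQ ^ 2 * varZ ^ 4 := by
  have h := genFun_123_231_321 (X 0 : Coeffs) 1 (X 1)
  rw [← genFun_triple_map_inv, map_inv_p123, map_inv_p231, map_inv_p321, ← F_eq_genFun] at h
  simp only [map_one] at h
  simp only [varX, varQ, varZ]
  linear_combination h

end Formulas

end PatternAvoidance

theorem mainTheorem10 :
    let x : Coeffs⟦X⟧ := varX
    let q : Coeffs⟦X⟧ := varQ
    let z : Coeffs⟦X⟧ := varZ
    F {p123, p132, p213} =
      frac (1 + x * z + (x ^ 2 - q) * z ^ 2 + (-x * q + q ^ 2 + q) * z ^ 3 - x ^ 2 * q * z ^ 4)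
        ((1 + q * z ^ 2) * (1 - 3 * q * z ^ 2 + q ^ 2 * z ^ 4)) ∧
    F {p231, p312, p321} =
      frac (1)
        (1 - x * z - q * z ^ 2) ∧
    F {p123, p132, p231} =
      frac (1 + x * z + (x ^ 2 - q) * z ^ 2 + q * z ^ 3 + (-x ^ 2 * q + x * q + q ^ 2) * z ^ 4)
        ((1 - q * z ^ 2) ^ 2) ∧
    F {p123, p213, p231} =
      frac (1 + x * z + (x ^ 2 - q) * z ^ 2 + q * z ^ 3 + (-x ^ 2 * q + x * q + q ^ 2) * z ^ 4)
        ((1 - q * z ^ 2) ^ 2) ∧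
    F {p123, p132, p312} =
      frac (1 + x * z + (x ^ 2 - q) * z ^ 2 + q ^ 2 * z ^ 3 + (-x ^ 2 * q + x * q ^ 2 + q ^ 2) * z ^ 4)
        ((1 - q * z ^ 2) ^ 2) ∧
    F {p123, p213, p312} =
      frac (1 + x * z + (x ^ 2 - q) * z ^ 2 + q ^ 2 * z ^ 3 + (-x ^ 2 * q + x * q ^ 2 + q ^ 2) * z ^ 4)
        ((1 - q * z ^ 2) ^ 2) ∧
    F {p132, p231, p321} =
      frac (1 - z + q * z ^ 2)
        ((1 - z) * (1 - x * z)) ∧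
    F {p213, p231, p321} =
      frac (1 - z + q * z ^ 2)
        ((1 - z) * (1 - x * z)) ∧
    F {p132, p312, p321} =
      frac (1 - q * z + q * z ^ 2)
        ((1 - x * z) * (1 - q * z)) ∧
    F {p213, p312, p321} =
      frac (1 - q * z + q * z ^ 2)
        ((1 - x * z) * (1 - q * z)) ∧
    F {p132, p213, p231} =
      frac (1 - z - q * z ^ 2 + 2 * q * z ^ 3 + (-x ^ 2 * q + q ^ 2 - x * q) * z ^ 4 + (x ^ 2 * q - 2 * q ^ 2) * z ^ 5 + x * q ^ 2 * z ^ 6)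
        ((1 - z) * (1 - x * z) * (1 - q * z ^ 2) ^ 2) ∧
    F {p132, p213, p312} =
      frac (1 - q * z - q * z ^ 2 + 2 * q ^ 2 * z ^ 3 + (-x ^ 2 * q - x * q ^ 2 + q ^ 2) * z ^ 4 + (x ^ 2 * q ^ 2 - 2 * q ^ 3) * z ^ 5 + x * q ^ 3 * z ^ 6)
        ((1 - x * z) * (1 - q * z) * (1 - q * z ^ 2) ^ 2) ∧
    F {p132, p231, p312} =
      frac (1 + x * q * z ^ 3)
        ((1 - x * z) * (1 - q * z ^ 2)) ∧
    F {p213, p231, p312} =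
      frac (1 + x * q * z ^ 3)
        ((1 - x * z) * (1 - q * z ^ 2)) ∧
    F {p123, p231, p312} =
      frac (1 + x * z + (x ^ 2 - q) * z ^ 2 + x * q * z ^ 3 + q ^ 2 * z ^ 4)
        ((1 - q * z ^ 2) ^ 2) ∧
    F {p132, p213, p321} =
      frac (1 - (1 + q) * z + 2 * q * z ^ 2 - x * q * z ^ 3)
        ((1 - z) * (1 - x * z) * (1 - q * z)) ∧
    F {p123, p132, p321} =
      1 + x * z + (x ^ 2 + q) * z ^ 2 + (x * q + q ^ 2 + q) * z ^ 3 + q ^ 2 * z ^ 4 ∧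
    F {p123, p213, p321} =
      1 + x * z + (x ^ 2 + q) * z ^ 2 + (x * q + q ^ 2 + q) * z ^ 3 + q ^ 2 * z ^ 4 ∧
    F {p123, p231, p321} =
      1 + x * z + (x ^ 2 + q) * z ^ 2 + (2 * x * q + q) * z ^ 3 + q ^ 2 * z ^ 4 ∧
    F {p123, p312, p321} =
      1 + x * z + (x ^ 2 + q) * z ^ 2 + (2 * x * q + q ^ 2) * z ^ 3 + q ^ 2 * z ^ 4 ∧
    (∀ S : Set Pattern, (∀ p ∈ S, p.1 = 3) → S.ncard = 3 →
      S ∈ ({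
        {p123, p132, p213},
        {p231, p312, p321},
        {p123, p132, p231},
        {p123, p213, p231},
        {p123, p132, p312},
        {p123, p213, p312},
        {p132, p231, p321},
        {p213, p231, p321},
        {p132, p312, p321},
        {p213, p312, p321},
        {p132, p213, p231},
        {p132, p213, p312},
        {p132, p231, p312},
        {p213, p231, p312},
        {p123, p231, p312},
        {p132, p213, p321},
        {p123, p132, p321},
        {p123, p213, p321},
        {p123, p231, p321},
        {p123, p312, p321}} : Set (Set Pattern))) := by
  intro x q z
  exact ⟨F_123_132_213, F_231_312_321,
    F_123_213_231_eq_F_123_132_231.symm.trans F_123_213_231, F_123_213_231,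
    F_123_213_312_eq_F_123_132_312.symm.trans F_123_213_312, F_123_213_312,
    F_132_231_321, F_213_231_321_eq_F_132_231_321.trans F_132_231_321,
    F_132_312_321, F_213_312_321_eq_F_132_312_321.trans F_132_312_321,
    F_132_213_231, F_132_213_312,
    F_132_231_312, F_213_231_312_eq_F_132_231_312.trans F_132_231_312,
    F_123_231_312, F_132_213_321,
    F_123_132_321, F_123_213_321_eq_F_123_132_321.trans F_123_132_321,
    F_123_231_321, F_123_312_321, fun _ => mem_of_ncard_eq_three⟩
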